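/- For a finite simple graph $G=(V,E)$ let $\Delta$ denote its maximum degree and let $$P_G(q)=\sum_{E'\subseteq E}(-1)^{|E'|}q^{C(E')}$$ be its chromatic polynomial, where $C(E')$ is the number of connected components of the spanning subgraph $(V,E')$; for every natural number $q$, $P_G(q)$ is the number of proper colorings of $G$ with $q$ colors. There is a constant $C$ such that for every finite simple graph $G$ $$P_G(q-1)\,P_G(q+1)\le P_G(q)^2\qquad\text{for all integers } q\ge C\Delta+1 .$$ In particular, this holds for $C=\sqrt2\,K^{*}$, where $$K^{*}=\min_{1<y<2}\frac{y}{(2-y)\log y}=6.907\ldots<7$$ (the minimum is attained, and $6.907\le K^{*}<6.908$). -/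

import Mathlib

open Polynomial

universe u

/-- The chromatic polynomial `P_G(X) = ∑_{E' ⊆ E(G)} (-1)^|E'| X^{C(E')}` of a finite simple graph
`G = (V, E)`, where `C(E')` is the number of connected components of the spanning subgraph
`(V, E')` (isolated vertices count as components). -/
noncomputable def chromaticPolynomial {V : Type*} [Fintype V] [DecidableEq V]
    (G : SimpleGraph V) [DecidableRel G.Adj] : ℤ[X] :=
  ∑ E' ∈ G.edgeFinset.powerset,
    (-1 : ℤ[X]) ^ E'.card *
      X ^ Nat.card (SimpleGraph.fromEdgeSet (E' : Set (Sym2 V))).ConnectedComponent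

/-- The functions on `V` that are constant along the edges in `E'` are the functions on the set of
connected components of `(V, E')`. -/
theorem card_constant_on_edges {V : Type*} [Fintype V] (E' : Set (Sym2 V)) (q : ℕ) :
    Nat.card {f : V → Fin q // ∀ e ∈ E', (e.map f).IsDiag} =
      q ^ Nat.card (SimpleGraph.fromEdgeSet E').ConnectedComponent := by
  classical
  have key : ∀ f : V → Fin q, (∀ e ∈ E', (e.map f).IsDiag) → ∀ v w : V,
      (SimpleGraph.fromEdgeSet E').Reachable v w → f v = f w := by
    rintro f hf v w ⟨p⟩
    induction p with
    | nil => rfl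
    | cons h _ ih =>
      rw [SimpleGraph.fromEdgeSet_adj] at h
      have := hf _ h.1
      simp at this
      exact this.trans ih
  have e : {f : V → Fin q // ∀ e ∈ E', (e.map f).IsDiag} ≃
      ((SimpleGraph.fromEdgeSet E').ConnectedComponent → Fin q) :=
    { toFun := fun f c => c.lift f.1 (fun v w p _ => key f.1 f.2 v w ⟨p⟩)
      invFun := fun g => ⟨fun v => g (SimpleGraph.connectedComponentMk _ v), by
        intro e
        induction e using Sym2.ind with
        | _ v w =>
          intro he
          by_cases hvw : v = w
          · simp [hvw]
          · have : (SimpleGraph.fromEdgeSet E').Adj v w := by simp [he, hvw]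
            simp [SimpleGraph.ConnectedComponent.sound this.reachable]⟩
      left_inv := fun f => by ext v; simp
      right_inv := fun g => by
        ext c
        induction c using SimpleGraph.ConnectedComponent.ind
        simp }
  rw [Nat.card_congr e]
  simp [Nat.card_eq_fintype_card]

/-- The value of the chromatic polynomial at a natural number `q` is the number of proper
colorings of `G` with `q` colors. -/
theorem chromaticPolynomial_eval_natCast {V : Type*} [Fintype V] [DecidableEq V]
    (G : SimpleGraph V) [DecidableRel G.Adj] (q : ℕ) :
    (chromaticPolynomial G).eval (q : ℤ) = Nat.card (G.Coloring (Fin q)) := by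
  classical
  have h1 : (chromaticPolynomial G).eval (q : ℤ) =
      ∑ E' ∈ G.edgeFinset.powerset, ∑ f : V → Fin q,
        if (∀ e ∈ E', (e.map f).IsDiag) then (-1 : ℤ) ^ E'.card else 0 := by
    rw [chromaticPolynomial, eval_finsetSum]
    refine Finset.sum_congr rfl fun E' _ => ?_
    have := card_constant_on_edges (E' : Set (Sym2 V)) q
    rw [Nat.card_eq_fintype_card, Fintype.card_subtype] at this
    rw [← Finset.sum_filter, Finset.sum_const]
    simp only [eval_mul, eval_pow, eval_neg, eval_one, eval_X, nsmul_eq_mul]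
    rw [mul_comm, ← Nat.cast_pow, ← this]
    simp
  rw [h1, Finset.sum_comm]
  have h2 : ∀ f : V → Fin q, (∑ E' ∈ G.edgeFinset.powerset,
      if (∀ e ∈ E', (e.map f).IsDiag) then (-1 : ℤ) ^ E'.card else 0) =
      if (∀ v w, G.Adj v w → f v ≠ f w) then 1 else 0 := by
    intro f
    rw [← Finset.sum_filter]
    have : G.edgeFinset.powerset.filter (fun E' => ∀ e ∈ E', (e.map f).IsDiag) =
        (G.edgeFinset.filter (fun e => (e.map f).IsDiag)).powerset := by
      ext E'
      simp only [Finset.mem_filter, Finset.mem_powerset, Finset.subset_iff]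
      grind
    rw [this, Finset.sum_powerset_neg_one_pow_card]
    congr 1
    rw [Finset.filter_eq_empty_iff, eq_iff_iff]
    constructor
    · intro h v w hvw
      have := @h s(v, w) (by simpa using hvw)
      simpa using this
    · intro h e
      induction e using Sym2.ind with
      | _ v w =>
        intro he
        have := h v w (by simpa using he)
        simpa using this
  rw [Finset.sum_congr rfl fun f _ => h2 f]
  rw [← Finset.sum_filter]
  simp only [Finset.sum_const, nsmul_eq_mul, mul_one]
  rw [← Fintype.card_subtype, ← Nat.card_eq_fintype_card]
  congr 1
  exact Nat.card_congr
    { toFun := fun f => SimpleGraph.Coloring.mk f.1 (fun {v w} h => f.2 v w h)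
      invFun := fun c => ⟨c, fun v w h => c.valid h⟩
      left_inv := fun f => rfl
      right_inv := fun c => rfl }

/-- The function `y ↦ y / ((2 - y) log y)`, to be considered for `1 < y < 2`. -/
noncomputable def fernandezProcacciFun (y : ℝ) : ℝ := y / ((2 - y) * Real.log y)

/-- The Fernández–Procacci constant `K* = min_{1 < y < 2} y / ((2 - y) log y) = 6.907…`. -/
noncomputable def fernandezProcacciConstant : ℝ :=
  sInf (fernandezProcacciFun '' Set.Ioo 1 2)

/-!
The zeros of the chromatic polynomial `P_G` lie in the disc `‖z‖ ≤ K* Δ`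
(`norm_le_of_aeval_chromaticPolynomial_eq_zero`), and this gives log-concavity: the quotient
`P(q - 1) P(q + 1) / P(q)²` is the product over the zeros `z` of `1 - (q - z)⁻²`, and for
`q ≥ √2 K* Δ + 1` the number `q - z` lies in a sector `|Im| + 1 ≤ Re`, so that each factor has
modulus at most `1` (`eval_mul_eval_le_sq`).

The disc is found with the polymer expansion. Let `P_U` be the chromatic polynomial of the subgraph
induced on `U` and `c(S)` the linear coefficient of `P_S`. Counting the colourings of `U` with
`p + q` colours in which `v` gets one of the first `p`, and taking the linear part in `p`, gives
`P_U(q) = q ∑_{v ∈ S ⊆ U} c(S) P_{U∖S}(q)` (`inducedChromatic_eq_sum`).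

At `q = 1` this is an identity for the indicator of the independent sets. In the convolution algebra
of set functions it writes `S ↦ c(S ∪ {v})` as a signed sum over disjoint families of polymers that
all meet the neighbourhood of `v`, which bounds its norm
`A_U(v) = ∑_{S ⊆ U} |c(S ∪ {v})| t^|S|`, for `v ∉ U`, by a product of `1 + t A_{U∖u}(u)` over the
neighbours `u ∈ U` of `v` (`setNorm_linCoeff_insert_le_prod`). Hence `A_U(v) ≤ R` as soon as
`exp(t Δ R) ≤ R` (`activity_le`).

With `t = y / ‖q‖` and `R = 2 - 1 / y`, the expansion shows by induction on `U` that `P_U(q) ≠ 0` and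
`‖P_{U∖v}(q)‖ ≤ t ‖P_U(q)‖`: the component `{v}` contributes `q P_{U∖v}(q)`, and all others together
at most the fraction `R - 1 = 1 - 1 / y` of it (`aeval_inducedChromatic_ne_zero`). In terms of `R`,
the condition `exp(t Δ R) ≤ R` reads `‖q‖ ≥ Δ R / ((2 - R) log R)`, which is where `K*` comes from.
-/

/-! ### Colourings and the component of a vertex -/

/-- The number of proper colourings of the subgraph of `G` induced on `U` with colours in `α`. -/
noncomputable def colorCount {V : Type*} (G : SimpleGraph V) (U : Finset V) (α : Type*) : ℕ :=
  Nat.card {f : U → α // ∀ x y : U, G.Adj x y → f x ≠ f y}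

open scoped Classical in
/-- The chromatic polynomial of the subgraph of `G` induced on `U`. -/
noncomputable def inducedChromatic {V : Type*} (G : SimpleGraph V) (U : Finset V) : ℤ[X] :=
  chromaticPolynomial (G.induce (U : Set V))

theorem inducedChromatic_eval_natCast {V : Type*} (G : SimpleGraph V) (U : Finset V) (q : ℕ) :
    (inducedChromatic G U).eval (q : ℤ) = colorCount G U (Fin q) := by
  classical
  rw [inducedChromatic, chromaticPolynomial_eval_natCast, colorCount]
  congr 1
  exact Nat.card_congr
    { toFun := fun c => ⟨c, fun x y h => c.valid (v := x) (w := y) h⟩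
      invFun := fun f => SimpleGraph.Coloring.mk f.1 (fun {v w} h => f.2 v w h)
      left_inv := fun c => rfl
      right_inv := fun f => rfl }

theorem eq_of_eval_natCast {P Q : ℤ[X]} (h : ∀ n : ℕ, P.eval (n : ℤ) = Q.eval (n : ℤ)) :
    P = Q := by
  refine Polynomial.eq_of_infinite_eval_eq P Q ?_
  refine (Set.infinite_range_of_injective (Nat.cast_injective (R := ℤ))).mono ?_
  rintro _ ⟨n, rfl⟩
  exact h n

theorem inducedChromatic_univ {V : Type*} [Fintype V] [DecidableEq V] (G : SimpleGraph V)
    [DecidableRel G.Adj] : inducedChromatic G Finset.univ = chromaticPolynomial G := by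
  refine eq_of_eval_natCast fun n => ?_
  rw [inducedChromatic_eval_natCast, chromaticPolynomial_eval_natCast, colorCount]
  congr 1
  exact Nat.card_congr
    { toFun := fun f => SimpleGraph.Coloring.mk (fun v => f.1 ⟨v, Finset.mem_univ v⟩)
        (fun {v w} h => f.2 _ _ h)
      invFun := fun c => ⟨fun x => c x.1, fun x y h => c.valid h⟩
      left_inv := fun f => rfl
      right_inv := fun c => rfl }

theorem colorCount_congr {V : Type*} (G : SimpleGraph V) (U : Finset V) {α β : Type*}
    (e : α ≃ β) : colorCount G U α = colorCount G U β :=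
  Nat.card_congr
    { toFun := fun f => ⟨fun x => e (f.1 x), fun x y h => by simpa using f.2 x y h⟩
      invFun := fun f => ⟨fun x => e.symm (f.1 x), fun x y h => by simpa using f.2 x y h⟩
      left_inv := fun f => by ext; simp
      right_inv := fun f => by ext; simp }

theorem colorCount_empty {V : Type*} (G : SimpleGraph V) (α : Type*) :
    colorCount G ∅ α = 1 := by
  rw [colorCount, Nat.card_eq_one_iff_unique]
  exact ⟨⟨fun f g => Subtype.ext (funext fun x => absurd x.2 (Finset.notMem_empty _))⟩,
    ⟨⟨fun x => absurd x.2 (Finset.notMem_empty _), fun x => absurd x.2 (Finset.notMem_empty _)⟩⟩⟩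

/-- Permuting the colours shows that all colours are used equally often at a vertex `v`. -/
theorem card_mul_card_coloring_vertex {V : Type*} (G : SimpleGraph V) (U : Finset V)
    (α : Type*) [Fintype α] (p : α → Prop) [DecidablePred p] (v : U) :
    Fintype.card α * Nat.card {f : {f : U → α // ∀ x y : U, G.Adj x y → f x ≠ f y} // p (f.1 v)} =
      Fintype.card {a // p a} * colorCount G U α := by
  classical
  set K := {f : U → α // ∀ x y : U, G.Adj x y → f x ≠ f y}
  have hswap : ∀ i j : α, Nat.card {f : K // f.1 v = i} = Nat.card {f : K // f.1 v = j} := by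
    intro i j
    have hv : ∀ (i j : α) (f : {f : K // f.1 v = i}), Equiv.swap i j (f.1.1 v) = j := by
      intro i j f; rw [f.2, Equiv.swap_apply_left]
    exact Nat.card_congr
      { toFun := fun f => ⟨⟨fun x => Equiv.swap i j (f.1.1 x),
          fun x y h => by simpa using f.1.2 x y h⟩, hv i j f⟩
        invFun := fun f => ⟨⟨fun x => Equiv.swap j i (f.1.1 x),
          fun x y h => by simpa using f.1.2 x y h⟩, hv j i f⟩
        left_inv := fun f => by ext; simp [Equiv.swap_comm j i]
        right_inv := fun f => by ext; simp [Equiv.swap_comm j i] }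
  have hsum : ∀ (p : α → Prop) [DecidablePred p], Nat.card {f : K // p (f.1 v)} =
      ∑ i : {a // p a}, Nat.card {f : K // f.1 v = i} := by
    intro p _
    rw [← Nat.card_sigma]
    exact Nat.card_congr
      { toFun := fun f => ⟨⟨f.1.1 v, f.2⟩, ⟨f.1, rfl⟩⟩
        invFun := fun f => ⟨f.2.1, by rw [f.2.2]; exact f.1.2⟩
        left_inv := fun f => rfl
        right_inv := by rintro ⟨⟨i, hi⟩, ⟨f, hf⟩⟩; have h : f.1 v = i := hf; subst h; rfl }
  have hall : colorCount G U α = ∑ i : α, Nat.card {f : K // f.1 v = i} := by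
    rw [← Nat.card_sigma]
    exact Nat.card_congr (Equiv.sigmaFiberEquiv (fun f : K => f.1 v)).symm
  rcases isEmpty_or_nonempty α with hα | ⟨⟨i⟩⟩
  · simp
  · have h1 : ∑ j : {a // p a}, Nat.card {f : K // f.1 v = j} =
        ∑ _j : {a // p a}, Nat.card {f : K // f.1 v = i} :=
      Finset.sum_congr rfl fun j _ => hswap j i
    have h2 : ∑ j : α, Nat.card {f : K // f.1 v = j} =
        ∑ _j : α, Nat.card {f : K // f.1 v = i} :=
      Finset.sum_congr rfl fun j _ => hswap j i
    rw [hsum p, hall, h1, h2]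
    simp only [Finset.sum_const, Finset.card_univ, smul_eq_mul]
    ring

/-- A colouring by `α ⊕ β` is a colouring by `α` of the set `S` of vertices with a colour in `α`,
together with a colouring by `β` of the rest. -/
theorem card_coloring_sum {V : Type*} [DecidableEq V] (G : SimpleGraph V) (U : Finset V)
    (α β : Type*) [Finite α] [Finite β] (v : U) :
    Nat.card {f : {f : U → α ⊕ β // ∀ x y : U, G.Adj x y → f x ≠ f y} // (f.1 v).isLeft} =
      ∑ S ∈ U.powerset with v.1 ∈ S, colorCount G S α * colorCount G (U \ S) β := by
  classical
  set K := {f : U → α ⊕ β // ∀ x y : U, G.Adj x y → f x ≠ f y}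
  have : Fintype K := Fintype.ofFinite K
  rw [Nat.card_eq_fintype_card, Fintype.card_subtype]
  rw [Finset.card_eq_sum_card_fiberwise
    (f := fun f : K => (Finset.univ.filter fun x : U => (f.1 x).isLeft).map
      (Function.Embedding.subtype _)) (t := U.powerset.filter (v.1 ∈ ·))]
  swap
  · intro f hf
    simp only [Finset.coe_filter, Finset.mem_univ, true_and, Set.mem_ofPred_eq] at hf
    simp only [Finset.coe_filter, Finset.mem_powerset, Set.mem_ofPred_eq]
    constructor
    · intro x; simp only [Finset.mem_map]; rintro ⟨a, -, rfl⟩; exact a.2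
    · simp only [Finset.mem_map]; exact ⟨v, by simpa using hf, rfl⟩
  refine Finset.sum_congr rfl fun S hS => ?_
  rw [Finset.mem_filter, Finset.mem_powerset] at hS
  obtain ⟨hSU, hvS⟩ := hS
  have hiff : ∀ f : K, ((Finset.univ.filter fun x : U => (f.1 x).isLeft).map
      (Function.Embedding.subtype _) = S) ↔ ∀ x : U, (f.1 x).isLeft ↔ x.1 ∈ S := by
    intro f
    constructor
    · rintro rfl x; simp
    · intro h; ext x
      simp only [Finset.mem_map, Finset.mem_filter, Finset.mem_univ, true_and,
        Function.Embedding.subtype_apply, Subtype.exists, exists_and_right, exists_eq_right]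
      constructor
      · rintro ⟨hx, hl⟩; exact (h ⟨x, hx⟩).1 hl
      · intro hx; exact ⟨hSU hx, (h ⟨x, hSU hx⟩).2 hx⟩
  rw [Finset.filter_filter]
  have hfil : (Finset.univ.filter fun f : K => (f.1 v).isLeft ∧
      (Finset.univ.filter fun x : U => (f.1 x).isLeft).map (Function.Embedding.subtype _) = S) =
      Finset.univ.filter fun f : K => ∀ x : U, (f.1 x).isLeft ↔ x.1 ∈ S := by
    ext f
    simp only [Finset.mem_filter, Finset.mem_univ, true_and, hiff]
    exact ⟨fun h => h.2, fun h => ⟨(h v).2 hvS, h⟩⟩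
  rw [hfil, ← Fintype.card_subtype, ← Nat.card_eq_fintype_card, colorCount, colorCount,
    ← Nat.card_prod]
  refine Nat.card_congr
    { toFun := fun f =>
        ⟨⟨fun x => (f.1.1 ⟨x, hSU x.2⟩).getLeft ((f.2 _).2 x.2), ?_⟩,
         ⟨fun x => (f.1.1 ⟨x, Finset.sdiff_subset x.2⟩).getRight (by
            rw [← Sum.not_isLeft, f.2]
            exact (Finset.mem_sdiff.1 x.2).2), ?_⟩⟩
      invFun := fun gh =>
        ⟨⟨fun x => if hx : x.1 ∈ S then Sum.inl (gh.1.1 ⟨x, hx⟩)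
          else Sum.inr (gh.2.1 ⟨x, Finset.mem_sdiff.2 ⟨x.2, hx⟩⟩), ?_⟩, ?_⟩
      left_inv := ?_
      right_inv := ?_ }
  · intro x y h heq
    have := congrArg (Sum.inl (β := β)) heq
    simp only [Sum.inl_getLeft] at this
    exact f.1.2 ⟨x, hSU x.2⟩ ⟨y, hSU y.2⟩ h this
  · intro x y h heq
    have := congrArg (Sum.inr (α := α)) heq
    simp only [Sum.inr_getRight] at this
    exact f.1.2 ⟨x, Finset.sdiff_subset x.2⟩ ⟨y, Finset.sdiff_subset y.2⟩ h this
  · intro x y h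
    have h1 := gh.1.2
    have h2 := gh.2.2
    by_cases hx : x.1 ∈ S <;> by_cases hy : y.1 ∈ S <;> simp only [hx, hy, dite_true, dite_false]
    · simpa using h1 ⟨x, hx⟩ ⟨y, hy⟩ h
    · simp
    · simp
    · simpa using h2 ⟨x, Finset.mem_sdiff.2 ⟨x.2, hx⟩⟩ ⟨y, Finset.mem_sdiff.2 ⟨y.2, hy⟩⟩ h
  · intro x
    by_cases hx : x.1 ∈ S <;> simp [hx]
  · intro f
    ext x : 3
    by_cases hx : x.1 ∈ S <;> simp [hx]
  · rintro ⟨⟨g, hg⟩, ⟨h, hh⟩⟩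
    simp only [Prod.mk.injEq, Subtype.mk.injEq]
    constructor
    · funext x; simp
    · funext x; simp [(Finset.mem_sdiff.1 x.2).2]

theorem inducedChromatic_empty {V : Type*} (G : SimpleGraph V) :
    inducedChromatic G ∅ = 1 :=
  eq_of_eval_natCast fun n => by
    rw [inducedChromatic_eval_natCast, colorCount_empty]; simp

theorem inducedChromatic_eval_zero {V : Type*} (G : SimpleGraph V) {U : Finset V}
    (hU : U.Nonempty) : (inducedChromatic G U).eval 0 = 0 := by
  have := inducedChromatic_eval_natCast G U 0
  obtain ⟨v, hv⟩ := hU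
  have h0 : colorCount G U (Fin 0) = 0 := by
    have : IsEmpty {f : U → Fin 0 // ∀ x y : U, G.Adj x y → f x ≠ f y} :=
      ⟨fun f => (f.1 ⟨v, hv⟩).elim0⟩
    exact Nat.card_of_isEmpty
  simpa [h0] using this

theorem inducedChromatic_eval_one {V : Type*} (G : SimpleGraph V) (U : Finset V)
    [Decidable (∀ x ∈ U, ∀ y ∈ U, ¬ G.Adj x y)] :
    (inducedChromatic G U).eval 1 = if ∀ x ∈ U, ∀ y ∈ U, ¬ G.Adj x y then 1 else 0 := by
  have := inducedChromatic_eval_natCast G U 1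
  rw [Nat.cast_one] at this
  rw [this, colorCount]
  split_ifs with h
  · norm_cast
    rw [Nat.card_eq_one_iff_unique]
    exact ⟨inferInstance, ⟨⟨fun _ => 0, fun x y hxy => (h x x.2 y y.2 hxy).elim⟩⟩⟩
  · norm_cast
    have : IsEmpty {f : U → Fin 1 // ∀ x y : U, G.Adj x y → f x ≠ f y} :=
      ⟨fun f => h fun x hx y hy hxy => f.2 ⟨x, hx⟩ ⟨y, hy⟩ hxy (Subsingleton.elim _ _)⟩
    exact Nat.card_of_isEmpty

/-- The linear coefficient of the chromatic polynomial of the subgraph induced on `S`. It equals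
the sum of `(-1)^|E'|` over the connected spanning subgraphs `(S, E')`, that is, the activity of
the polymer `S`. -/
noncomputable def linCoeff {V : Type*} (G : SimpleGraph V) (S : Finset V) : ℤ :=
  (inducedChromatic G S).coeff 1

theorem sum_eval_mul_eval {V : Type*} [DecidableEq V] (G : SimpleGraph V) (U : Finset V)
    {v : V} (hv : v ∈ U) (p q : ℕ) :
    ((p : ℤ) + q) * ∑ S ∈ U.powerset with v ∈ S,
      (inducedChromatic G S).eval (p : ℤ) * (inducedChromatic G (U \ S)).eval (q : ℤ) =
      p * (inducedChromatic G U).eval ((p : ℤ) + q) := by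
  have h1 := card_mul_card_coloring_vertex G U (Fin p ⊕ Fin q) (fun a => a.isLeft) ⟨v, hv⟩
  have h2 : Fintype.card {a : Fin p ⊕ Fin q // a.isLeft} = p := by
    rw [Fintype.card_subtype, Finset.card_filter, Fintype.sum_sum_type]
    simp
  rw [card_coloring_sum, h2, colorCount_congr G U finSumFinEquiv] at h1
  have h3 := congrArg (Nat.cast : ℕ → ℤ) h1
  push_cast at h3
  simp only [Fintype.card_sum, Fintype.card_fin] at h3
  rw [← Nat.cast_add, inducedChromatic_eval_natCast]
  simp only [inducedChromatic_eval_natCast]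
  push_cast at h3 ⊢
  exact h3

/-- The decomposition of `P_U` according to the component `S` of a vertex `v`. It is the linear
part in `p` of `(p + q) ∑_{v ∈ S ⊆ U} P_S(p) P_{U∖S}(q) = p P_U(p + q)`. -/
theorem inducedChromatic_eq_sum {V : Type*} [DecidableEq V] (G : SimpleGraph V) (U : Finset V)
    {v : V} (hv : v ∈ U) :
    inducedChromatic G U =
      X * ∑ S ∈ U.powerset with v ∈ S, C (linCoeff G S) * inducedChromatic G (U \ S) := by
  refine eq_of_eval_natCast fun q => ?_
  have key : (X + C (q : ℤ)) * ∑ S ∈ U.powerset with v ∈ S,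
      inducedChromatic G S * C ((inducedChromatic G (U \ S)).eval (q : ℤ)) =
      X * (inducedChromatic G U).comp (X + C (q : ℤ)) := by
    refine eq_of_eval_natCast fun p => ?_
    have := sum_eval_mul_eval G U hv p q
    simpa [eval_finsetSum] using this
  have hc := congrArg (fun P => P.coeff 1) key
  have h0 : (∑ S ∈ U.powerset with v ∈ S,
      inducedChromatic G S * C ((inducedChromatic G (U \ S)).eval (q : ℤ))).coeff 0 = 0 := by
    rw [finsetSum_coeff]
    refine Finset.sum_eq_zero fun S hS => ?_
    rw [coeff_mul_C, coeff_zero_eq_eval_zero,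
      inducedChromatic_eval_zero G ⟨v, (Finset.mem_filter.1 hS).2⟩, zero_mul]
  simp only [add_mul, coeff_add, coeff_X_mul, coeff_C_mul, finsetSum_coeff, coeff_mul_C] at hc
  rw [coeff_zero_eq_eval_zero, eval_comp] at hc
  rw [finsetSum_coeff] at h0
  simp only [coeff_mul_C] at h0
  rw [h0, zero_add] at hc
  simp only [eval_add, eval_X, eval_C, zero_add] at hc
  rw [← hc]
  simp [eval_finsetSum, linCoeff]

/-! ### Convolution of set functions -/

/-- The convolution of set functions, `(f * g)(S) = ∑_{T ⊆ S} f(T) g(S ∖ T)`. -/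
def setConv {V : Type*} [DecidableEq V] (f g : Finset V → ℝ) (S : Finset V) : ℝ :=
  ∑ T ∈ S.powerset, f T * g (S \ T)

/-- The weighted `ℓ¹` norm `∑_{S ⊆ U} |f(S)| t^|S|` of the restriction of a set function to the
subsets of `U`. -/
def setNorm {V : Type*} (t : ℝ) (U : Finset V) (f : Finset V → ℝ) : ℝ :=
  ∑ S ∈ U.powerset, |f S| * t ^ S.card

theorem sum_powerset_sum_powerset_sdiff {V M : Type*} [DecidableEq V] [AddCommMonoid M]
    (U : Finset V) (F : Finset V → Finset V → M) :
    ∑ T ∈ U.powerset, ∑ B ∈ (U \ T).powerset, F T B =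
      ∑ D ∈ U.powerset, ∑ T ∈ D.powerset, F T (D \ T) := by
  rw [Finset.sum_sigma', Finset.sum_sigma']
  refine Finset.sum_bij' (fun x _ => ⟨x.1 ∪ x.2, x.1⟩) (fun x _ => ⟨x.2, x.1 \ x.2⟩) ?_ ?_ ?_ ?_ ?_
  · rintro ⟨T, B⟩ h
    simp only [Finset.mem_sigma, Finset.mem_powerset] at h ⊢
    exact ⟨Finset.union_subset h.1 (h.2.trans Finset.sdiff_subset), Finset.subset_union_left⟩
  · rintro ⟨D, T⟩ h
    simp only [Finset.mem_sigma, Finset.mem_powerset] at h ⊢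
    exact ⟨h.2.trans h.1, Finset.sdiff_subset_sdiff h.1 le_rfl⟩
  · rintro ⟨T, B⟩ h
    simp only [Finset.mem_sigma, Finset.mem_powerset, Finset.subset_sdiff] at h
    simp [Finset.union_sdiff_cancel_left h.2.2.symm]
  · rintro ⟨D, T⟩ h
    simp only [Finset.mem_sigma, Finset.mem_powerset] at h
    simp [Finset.union_sdiff_of_subset h.2]
  · rintro ⟨T, B⟩ h
    simp only [Finset.mem_sigma, Finset.mem_powerset, Finset.subset_sdiff] at h
    simp [Finset.union_sdiff_cancel_left h.2.2.symm]

theorem setConv_assoc {V : Type*} [DecidableEq V] (f g h : Finset V → ℝ) (S : Finset V) :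
    setConv (setConv f g) h S = setConv f (setConv g h) S := by
  simp only [setConv, Finset.sum_mul, Finset.mul_sum]
  rw [sum_powerset_sum_powerset_sdiff S fun T B => f T * (g B * h ((S \ T) \ B))]
  refine Finset.sum_congr rfl fun D hD => Finset.sum_congr rfl fun T hT => ?_
  rw [Finset.mem_powerset] at hD hT
  rw [mul_assoc, sdiff_sdiff_left, Finset.sup_eq_union, Finset.union_sdiff_of_subset hT]

theorem setNorm_nonneg {V : Type*} {t : ℝ} (ht : 0 ≤ t) (U : Finset V) (f : Finset V → ℝ) :
    0 ≤ setNorm t U f :=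
  Finset.sum_nonneg fun _ _ => by positivity

theorem setNorm_mono {V : Type*} {t : ℝ} (ht : 0 ≤ t) {U W : Finset V} (h : U ⊆ W)
    (f : Finset V → ℝ) : setNorm t U f ≤ setNorm t W f :=
  Finset.sum_le_sum_of_subset_of_nonneg (Finset.powerset_mono.2 h) fun _ _ _ => by positivity

theorem setNorm_setConv_le {V : Type*} [DecidableEq V] {t : ℝ} (ht : 0 ≤ t) (U : Finset V)
    (f g : Finset V → ℝ) :
    setNorm t U (setConv f g) ≤ setNorm t U f * setNorm t U g := by
  calc setNorm t U (setConv f g)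
      ≤ ∑ D ∈ U.powerset, ∑ T ∈ D.powerset,
          |f T| * t ^ T.card * (|g (D \ T)| * t ^ (D \ T).card) := by
        refine Finset.sum_le_sum fun D _ => ?_
        rw [setConv]
        refine (mul_le_mul_of_nonneg_right (Finset.abs_sum_le_sum_abs _ _) (by positivity)).trans ?_
        rw [Finset.sum_mul]
        refine le_of_eq (Finset.sum_congr rfl fun T hT => ?_)
        rw [Finset.mem_powerset] at hT
        rw [abs_mul, ← Finset.card_sdiff_add_card_eq_card hT, pow_add]
        ring
    _ = ∑ T ∈ U.powerset, |f T| * t ^ T.card * setNorm t (U \ T) g := by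
        rw [← sum_powerset_sum_powerset_sdiff U
          fun T B => |f T| * t ^ T.card * (|g B| * t ^ B.card)]
        simp only [setNorm, Finset.mul_sum]
    _ ≤ setNorm t U f * setNorm t U g := by
        rw [setNorm, Finset.sum_mul]
        exact Finset.sum_le_sum fun T _ => mul_le_mul_of_nonneg_left
          (setNorm_mono ht Finset.sdiff_subset g) (by positivity)

theorem setNorm_sub_le {V : Type*} {t : ℝ} (ht : 0 ≤ t) (U : Finset V) (f g : Finset V → ℝ) :
    setNorm t U (fun S => f S - g S) ≤ setNorm t U f + setNorm t U g := by
  rw [setNorm, setNorm, setNorm, ← Finset.sum_add_distrib]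
  refine Finset.sum_le_sum fun S _ => ?_
  rw [← add_mul]
  exact mul_le_mul_of_nonneg_right (abs_sub _ _) (by positivity)

/-- A set function `e` with `e(∅) = 1` can be cancelled from a convolution. -/
theorem eq_of_setConv_eq {V : Type*} [DecidableEq V] {f g e : Finset V → ℝ} (he : e ∅ = 1)
    {W : Finset V} (h : ∀ S ⊆ W, setConv f e S = setConv g e S) : ∀ S ⊆ W, f S = g S := by
  intro S
  induction S using Finset.strongInduction with
  | H S ih =>
    intro hS
    have h1 := h S hS
    rw [setConv, setConv, ← Finset.sum_erase_add _ _ (Finset.mem_powerset_self S),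
      ← Finset.sum_erase_add (S.powerset) _ (Finset.mem_powerset_self S), sdiff_self,
      Finset.bot_eq_empty, he, mul_one, mul_one] at h1
    rw [Finset.sum_congr (g := fun T => g T * e (S \ T)) rfl] at h1
    · exact add_left_cancel h1
    · intro T hT
      rw [Finset.mem_erase, Finset.mem_powerset] at hT
      rw [ih T (lt_of_le_of_ne hT.2 hT.1) (hT.2.trans hS)]

/-! ### Independent sets and the activity bound -/

open scoped Classical in
/-- The indicator function of the independent sets of `G` that avoid `N`. -/
noncomputable def indepAvoiding {V : Type*} (G : SimpleGraph V) (N S : Finset V) : ℝ :=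
  if (∀ x ∈ S, ∀ y ∈ S, ¬ G.Adj x y) ∧ Disjoint S N then 1 else 0

theorem indepAvoiding_empty_eq_eval {V : Type*} (G : SimpleGraph V) (S : Finset V) :
    indepAvoiding G ∅ S = ((inducedChromatic G S).eval 1 : ℤ) := by
  classical
  rw [inducedChromatic_eval_one, indepAvoiding]
  simp

/-- The decomposition of the indicator of independent sets by the component of a vertex. -/
theorem indepAvoiding_eq_sum {V : Type*} [DecidableEq V] (G : SimpleGraph V) {S : Finset V} {v : V}
    (hv : v ∈ S) : indepAvoiding G ∅ S =
      ∑ T ∈ S.powerset with v ∈ T, (linCoeff G T : ℝ) * indepAvoiding G ∅ (S \ T) := by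
  simp only [indepAvoiding_empty_eq_eval]
  rw [inducedChromatic_eq_sum G S hv]
  simp [eval_finsetSum]

theorem sum_powerset_insert_filter_mem {V M : Type*} [DecidableEq V] [AddCommMonoid M] {v : V}
    {S : Finset V} (hv : v ∉ S) (F : Finset V → M) :
    ∑ T ∈ (insert v S).powerset with v ∈ T, F T = ∑ T ∈ S.powerset, F (insert v T) := by
  rw [Finset.sum_filter, Finset.sum_powerset_insert hv, Finset.sum_eq_zero, zero_add]
  · simp
  · intro T hT
    rw [if_neg fun h => hv (Finset.mem_powerset.1 hT h)]

theorem linCoeff_singleton {V : Type*} (G : SimpleGraph V) (v : V) : linCoeff G {v} = 1 := by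
  classical
  have h := inducedChromatic_eval_one G {v}
  rw [if_pos (by simp), inducedChromatic_eq_sum G {v} (Finset.mem_singleton_self v),
    ← insert_empty_eq, sum_powerset_insert_filter_mem (Finset.notMem_empty v)] at h
  simpa [inducedChromatic_empty] using h

/-- Avoiding one more vertex `u` removes the polymers that contain `u` and avoid `N`. -/
theorem indepAvoiding_insert {V : Type*} [DecidableEq V] (G : SimpleGraph V) (N : Finset V)
    (u : V) (S : Finset V) :
    indepAvoiding G (insert u N) S = indepAvoiding G N S -
      setConv (fun T => if u ∈ T ∧ Disjoint T N then (linCoeff G T : ℝ) else 0)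
        (indepAvoiding G N) S := by
  classical
  by_cases hSN : Disjoint S N
  · have h0 : ∀ T ⊆ S, indepAvoiding G N T = indepAvoiding G ∅ T := by
      intro T hT
      simp [indepAvoiding, hSN.mono_left hT]
    have h1 : setConv (fun T => if u ∈ T ∧ Disjoint T N then (linCoeff G T : ℝ) else 0)
        (indepAvoiding G N) S =
        ∑ T ∈ S.powerset with u ∈ T, (linCoeff G T : ℝ) * indepAvoiding G ∅ (S \ T) := by
      rw [setConv, Finset.sum_filter]
      refine Finset.sum_congr rfl fun T hT => ?_
      rw [Finset.mem_powerset] at hT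
      rw [h0 _ Finset.sdiff_subset]
      simp [hSN.mono_left hT]
    rw [h1, h0 S le_rfl]
    by_cases hu : u ∈ S
    · rw [← indepAvoiding_eq_sum G hu, sub_self]
      simp [indepAvoiding, hu]
    · rw [Finset.sum_eq_zero, sub_zero]
      · simp [indepAvoiding, hu, hSN]
      · intro T hT
        rw [Finset.mem_filter, Finset.mem_powerset] at hT
        exact absurd (hT.1 hT.2) hu
  · rw [setConv, Finset.sum_eq_zero]
    · simp [indepAvoiding, hSN]
    · intro T hT
      rw [Finset.mem_powerset] at hT
      by_cases hT' : Disjoint T N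
      · have : ¬ Disjoint (S \ T) N := fun h => hSN <| by
          rw [← Finset.union_sdiff_of_subset hT, Finset.disjoint_union_left]
          exact ⟨hT', h⟩
        simp [indepAvoiding, this]
      · simp [hT']

/-- The total activity `∑_{v ∈ S ⊆ U} |c(S)| t^|S|` of the polymers through `v` inside `U`. -/
noncomputable def activity {V : Type*} [DecidableEq V] (G : SimpleGraph V) (t : ℝ) (U : Finset V)
    (v : V) : ℝ :=
  ∑ S ∈ U.powerset with v ∈ S, |(linCoeff G S : ℝ)| * t ^ S.card

theorem activity_nonneg {V : Type*} [DecidableEq V] (G : SimpleGraph V) {t : ℝ} (ht : 0 ≤ t)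
    (U : Finset V) (v : V) : 0 ≤ activity G t U v :=
  Finset.sum_nonneg fun _ _ => by positivity

/-- The quotient of the indicators of the independent sets avoiding `N` and of all independent
sets, in the convolution algebra, has norm at most `∏_{u ∈ N} (1 + activity u)`. In terms of
polymers it is the signed sum over the disjoint families of polymers that all meet `N`, and such
a family is obtained by choosing at most one polymer through each point of `N`. -/
theorem exists_setConv_eq_indepAvoiding {V : Type*} [DecidableEq V] (G : SimpleGraph V) {t : ℝ}
    (ht : 0 ≤ t) (N : Finset V) :
    ∃ g : Finset V → ℝ, (∀ S, indepAvoiding G N S = setConv g (indepAvoiding G ∅) S) ∧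
      ∀ U, setNorm t U g ≤ ∏ u ∈ N, (1 + activity G t U u) := by
  induction N using Finset.induction_on with
  | empty =>
    refine ⟨fun S => if S = ∅ then 1 else 0, fun S => ?_, fun U => ?_⟩
    · rw [setConv, Finset.sum_eq_single ∅] <;> simp +contextual
    · rw [setNorm, Finset.sum_eq_single ∅] <;> simp +contextual
  | insert u N hu ih =>
    obtain ⟨g, hg, hgU⟩ := ih
    set k : Finset V → ℝ := fun T => if u ∈ T ∧ Disjoint T N then (linCoeff G T : ℝ) else 0
      with hk
    refine ⟨fun S => g S - setConv k g S, fun S => ?_, fun U => ?_⟩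
    · have h1 : setConv (fun S => g S - setConv k g S) (indepAvoiding G ∅) S =
          setConv g (indepAvoiding G ∅) S -
            setConv (setConv k g) (indepAvoiding G ∅) S := by
        simp only [setConv, sub_mul, Finset.sum_sub_distrib]
      rw [h1, setConv_assoc, ← funext hg, indepAvoiding_insert]
    · have hkU : setNorm t U k ≤ activity G t U u := by
        rw [setNorm, activity, Finset.sum_filter]
        refine Finset.sum_le_sum fun S _ => ?_
        by_cases h1 : u ∈ S
        · by_cases h2 : Disjoint S N
          · simp [hk, h1, h2]
          · simp only [hk, h1, h2, and_false, if_false, abs_zero, zero_mul, if_true]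
            positivity
        · simp [hk, h1]
      rw [Finset.prod_insert hu]
      have h0 := setNorm_nonneg ht U g
      calc setNorm t U (fun S => g S - setConv k g S)
          ≤ setNorm t U g + setNorm t U k * setNorm t U g :=
            (setNorm_sub_le ht U _ _).trans (add_le_add_right (setNorm_setConv_le ht U k g) _)
        _ ≤ (1 + activity G t U u) * setNorm t U g := by
            nlinarith [mul_le_mul_of_nonneg_right hkU h0]
        _ ≤ _ := mul_le_mul_of_nonneg_left (hgU U)
            (add_nonneg zero_le_one (activity_nonneg G ht U u))

theorem indepAvoiding_insert_eq_neighborFinset {V : Type*} [Fintype V] [DecidableEq V]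
    (G : SimpleGraph V) [DecidableRel G.Adj] (v : V) (S : Finset V) :
    indepAvoiding G ∅ (insert v S) = indepAvoiding G (G.neighborFinset v) S := by
  have : (∀ x ∈ insert v S, ∀ y ∈ insert v S, ¬ G.Adj x y) ↔
      (∀ x ∈ S, ∀ y ∈ S, ¬ G.Adj x y) ∧ Disjoint S (G.neighborFinset v) := by
    simp only [Finset.disjoint_left, SimpleGraph.mem_neighborFinset, Finset.mem_insert,
      forall_eq_or_imp, SimpleGraph.irrefl, not_false_eq_true, true_and]
    constructor
    · rintro ⟨h1, h2⟩
      exact ⟨fun x hx y hy => (h2 x hx).2 y hy, fun x hx => h1 x hx⟩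
    · rintro ⟨h1, h2⟩
      exact ⟨fun x hx => h2 x hx, fun x hx => ⟨fun h => h2 x hx h.symm, h1 x hx⟩⟩
  simp only [indepAvoiding, Finset.disjoint_empty_right, and_true]
  split_ifs with h1 h2 h2
  · rfl
  · exact absurd (this.1 h1) h2
  · exact absurd (this.2 h2) h1
  · rfl

/-- Removing `v` from a polymer leaves disjoint polymers that all meet the neighbourhood of `v`. -/
theorem setNorm_linCoeff_insert_le_prod {V : Type*} [Fintype V] [DecidableEq V]
    (G : SimpleGraph V) [DecidableRel G.Adj] {t : ℝ} (ht : 0 ≤ t) {v : V} {U : Finset V}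
    (hv : v ∉ U) :
    setNorm t U (fun S => (linCoeff G (insert v S) : ℝ)) ≤
      ∏ u ∈ G.neighborFinset v, (1 + activity G t U u) := by
  obtain ⟨g, hg, hgU⟩ := exists_setConv_eq_indepAvoiding G ht (G.neighborFinset v)
  have heq : ∀ S ⊆ U, (linCoeff G (insert v S) : ℝ) = g S := by
    refine eq_of_setConv_eq (e := indepAvoiding G ∅) (by simp [indepAvoiding]) fun S hS => ?_
    have hvS : v ∉ S := fun h => hv (hS h)
    rw [← hg, ← indepAvoiding_insert_eq_neighborFinset,
      indepAvoiding_eq_sum G (Finset.mem_insert_self v S), sum_powerset_insert_filter_mem hvS,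
      setConv]
    refine Finset.sum_congr rfl fun T hT => ?_
    rw [Finset.insert_sdiff_insert, Finset.sdiff_insert_of_notMem hvS]
  refine le_trans (le_of_eq ?_) (hgU U)
  exact Finset.sum_congr rfl fun S hS => by
    simp only [heq S (Finset.mem_powerset.1 hS)]

theorem activity_insert {V : Type*} [DecidableEq V] (G : SimpleGraph V) (t : ℝ) {v : V}
    {U : Finset V} (hv : v ∉ U) : activity G t (insert v U) v =
      t * setNorm t U (fun S => (linCoeff G (insert v S) : ℝ)) := by
  rw [activity, sum_powerset_insert_filter_mem hv, setNorm, Finset.mul_sum]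
  refine Finset.sum_congr rfl fun S hS => ?_
  rw [Finset.card_insert_of_notMem fun h => hv (Finset.mem_powerset.1 hS h)]
  ring

/-- If `exp(t Δ R) ≤ R`, then the activity through a vertex is at most `t R`: by induction on `U`,
the activity is at most `t (1 + t R)^Δ ≤ t exp(t Δ R)`. -/
theorem activity_le {V : Type*} [Fintype V] [DecidableEq V] (G : SimpleGraph V)
    [DecidableRel G.Adj] {t R : ℝ} (ht : 0 ≤ t) (hR : Real.exp (t * G.maxDegree * R) ≤ R)
    (U : Finset V) : ∀ v, activity G t U v ≤ t * R := by
  have hR0 : 0 ≤ R := (Real.exp_pos _).le.trans hR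
  induction U using Finset.strongInduction with
  | H U ih =>
    intro v
    by_cases hv : v ∈ U
    · have hb : ∀ u, activity G t (U.erase v) u ≤ t * R := ih _ (Finset.erase_ssubset hv)
      have h1 : setNorm t (U.erase v) (fun S => (linCoeff G (insert v S) : ℝ)) ≤ R := by
        refine (setNorm_linCoeff_insert_le_prod G ht (Finset.notMem_erase v U)).trans ?_
        calc ∏ u ∈ G.neighborFinset v, (1 + activity G t (U.erase v) u)
            ≤ ∏ u ∈ G.neighborFinset v, Real.exp (t * R) := by
              refine Finset.prod_le_prod (fun u _ => add_nonneg zero_le_one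
                (activity_nonneg G ht _ u)) fun u _ => ?_
              linarith [hb u, Real.add_one_le_exp (t * R)]
          _ = Real.exp (G.degree v * (t * R)) := by
              rw [Finset.prod_const, SimpleGraph.card_neighborFinset_eq_degree, Real.exp_nat_mul]
          _ ≤ Real.exp (t * G.maxDegree * R) := by
              rw [Real.exp_le_exp]
              have : (G.degree v : ℝ) ≤ G.maxDegree := by exact_mod_cast G.degree_le_maxDegree v
              nlinarith [mul_le_mul_of_nonneg_right this (mul_nonneg ht hR0)]
          _ ≤ R := hR
      rw [← Finset.insert_erase hv, activity_insert G t (Finset.notMem_erase v U)]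
      exact mul_le_mul_of_nonneg_left h1 ht
    · rw [activity, Finset.sum_eq_zero]
      · positivity
      · intro S hS
        rw [Finset.mem_filter, Finset.mem_powerset] at hS
        exact absurd (hS.1 hS.2) hv

theorem setNorm_linCoeff_insert_le {V : Type*} [Fintype V] [DecidableEq V] (G : SimpleGraph V)
    [DecidableRel G.Adj] {t R : ℝ} (ht : 0 < t) (hR : Real.exp (t * G.maxDegree * R) ≤ R)
    {v : V} {U : Finset V} (hv : v ∉ U) :
    setNorm t U (fun S => (linCoeff G (insert v S) : ℝ)) ≤ R := by
  have h := activity_le G ht.le hR (insert v U) v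
  rw [activity_insert G t hv] at h
  exact le_of_mul_le_mul_left h ht

/-! ### The zero-free region -/

/-- The zero-free region of the chromatic polynomials of the induced subgraphs, with a bound on
the ratios of their values, by induction on `U`. In the expansion of `P_U(q)` by the component of
`v`, the component `{v}` gives `q P_{U∖v}(q)`, and the ratio bound for smaller sets shows that the
other components together contribute at most the fraction `R - 1` of it. -/
theorem aeval_inducedChromatic_ne_zero {V : Type*} [Fintype V] [DecidableEq V]
    (G : SimpleGraph V) [DecidableRel G.Adj] {R : ℝ} (hR2 : R < 2) {q : ℂ}
    (hq : q ≠ 0)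
    (hR : Real.exp ((2 - R)⁻¹ / ‖q‖ * G.maxDegree * R) ≤ R) (U : Finset V) :
    aeval q (inducedChromatic G U) ≠ 0 ∧
      ∀ v ∈ U, ‖aeval q (inducedChromatic G (U.erase v))‖ ≤
        (2 - R)⁻¹ / ‖q‖ * ‖aeval q (inducedChromatic G U)‖ := by
  have hq0 : 0 < ‖q‖ := norm_pos_iff.2 hq
  have hy : 0 < (2 - R)⁻¹ := inv_pos.2 (by linarith)
  set t := (2 - R)⁻¹ / ‖q‖ with ht_def
  have ht : 0 < t := div_pos hy hq0
  induction U using Finset.strongInduction with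
  | H U ih =>
    have hchain : ∀ W, W ⊂ U → ∀ D, D ⊆ W → ‖aeval q (inducedChromatic G (W \ D))‖ ≤
        t ^ D.card * ‖aeval q (inducedChromatic G W)‖ := by
      intro W hW D
      induction D using Finset.induction_on with
      | empty => simp
      | insert a D ha ihD =>
        intro hD
        have hDW := (Finset.subset_insert a D).trans hD
        have haW : a ∈ W \ D :=
          Finset.mem_sdiff.2 ⟨hD (Finset.mem_insert_self a D), ha⟩
        have h1 := (ih (W \ D) (lt_of_le_of_lt Finset.sdiff_subset hW)).2 a haW
        rw [← Finset.sdiff_insert] at h1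
        rw [Finset.card_insert_of_notMem ha, pow_succ', mul_assoc]
        exact h1.trans (mul_le_mul_of_nonneg_left (ihD hDW) ht.le)
    have hmain : ∀ v ∈ U, ‖q‖ * (2 - R) * ‖aeval q (inducedChromatic G (U.erase v))‖ ≤
        ‖aeval q (inducedChromatic G U)‖ := by
      intro v hv
      set W := U.erase v with hW
      have hvW : v ∉ W := Finset.notMem_erase v U
      set c : Finset V → ℝ := fun S => (linCoeff G (insert v S) : ℝ) with hc
      set p := aeval q (inducedChromatic G W) with hp
      have hexp : aeval q (inducedChromatic G U) =
          q * ∑ S ∈ W.powerset, (c S : ℂ) * aeval q (inducedChromatic G (W \ S)) := by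
        rw [inducedChromatic_eq_sum G U hv, ← Finset.insert_erase hv, ← hW,
          sum_powerset_insert_filter_mem hvW, map_mul, aeval_X, map_sum]
        congr 1
        refine Finset.sum_congr rfl fun S hS => ?_
        rw [Finset.insert_sdiff_insert, Finset.sdiff_insert_of_notMem hvW]
        simp [hc]
      have hnorm := setNorm_linCoeff_insert_le G ht hR hvW
      have hempty : ∅ ∈ W.powerset := Finset.empty_mem_powerset W
      rw [setNorm, ← Finset.add_sum_erase _ _ hempty] at hnorm
      rw [← Finset.add_sum_erase _ _ hempty] at hexp
      have hc0 : c ∅ = 1 := by simp [hc, linCoeff_singleton]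
      have hrest : ‖∑ S ∈ W.powerset.erase ∅, (c S : ℂ) * aeval q (inducedChromatic G (W \ S))‖ ≤
          (R - 1) * ‖p‖ := by
        calc _ ≤ ∑ S ∈ W.powerset.erase ∅, |c S| * t ^ S.card * ‖p‖ := by
              refine norm_sum_le_of_le _ fun S hS => ?_
              rw [norm_mul, Complex.norm_real, Real.norm_eq_abs, mul_assoc]
              exact mul_le_mul_of_nonneg_left (hchain W (Finset.erase_ssubset hv) S
                (Finset.mem_powerset.1 (Finset.mem_of_mem_erase hS))) (abs_nonneg _)
          _ ≤ (R - 1) * ‖p‖ := by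
              rw [← Finset.sum_mul]
              refine mul_le_mul_of_nonneg_right ?_ (norm_nonneg _)
              simp only [insert_empty_eq, linCoeff_singleton, Int.cast_one, abs_one,
                Finset.card_empty, pow_zero, mul_one] at hnorm
              linarith
      rw [hc0, Finset.sdiff_empty, ← hp, Complex.ofReal_one, one_mul] at hexp
      rw [hexp, norm_mul, mul_assoc]
      refine mul_le_mul_of_nonneg_left ?_ hq0.le
      have := norm_sub_le_norm_add p
        (∑ S ∈ W.powerset.erase ∅, (c S : ℂ) * aeval q (inducedChromatic G (W \ S)))
      linarith
    constructor
    · rcases U.eq_empty_or_nonempty with rfl | ⟨v, hv⟩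
      · simp [inducedChromatic_empty]
      · have h1 : 0 < ‖aeval q (inducedChromatic G (U.erase v))‖ :=
          norm_pos_iff.2 (ih _ (Finset.erase_ssubset hv)).1
        refine norm_pos_iff.1 (lt_of_lt_of_le ?_ (hmain v hv))
        have : 0 < 2 - R := by linarith
        positivity
    · intro v hv
      have h1 := mul_le_mul_of_nonneg_left (hmain v hv) ht.le
      refine le_trans (le_of_eq ?_) h1
      have : (2 - R) ≠ 0 := by linarith
      rw [ht_def]
      field_simp

/-! ### The constant `K*` -/

theorem log_le_of_sum_exp {a b : ℝ} (ha : 0 < a) (hb : 0 ≤ b) (n : ℕ)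
    (h : a ≤ ∑ i ∈ Finset.range n, b ^ i / (i.factorial : ℝ)) : Real.log a ≤ b :=
  (Real.log_le_iff_le_exp ha).2 (h.trans (Real.sum_le_exp_of_nonneg hb n))

theorem log_one_point_three_seven_le : Real.log (137 / 100) ≤ 0.31482 := by
  refine log_le_of_sum_exp (by norm_num) (by norm_num) 8 ?_
  norm_num [Finset.sum_range_succ, Nat.factorial]

theorem le_log_one_point_three_seven : 0.3148 ≤ Real.log (137 / 100) := by
  rw [Real.le_log_iff_exp_le (by norm_num)]
  refine (Real.exp_bound' (by norm_num) (by norm_num) (n := 8) (by norm_num)).trans ?_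
  norm_num [Finset.sum_range_succ, Nat.factorial]

/-- The tangent of `log` at `1.37`, which is close to the minimiser `1.37015…`, reduces the lower
bound to a quadratic inequality. -/
theorem le_fernandezProcacciFun {y : ℝ} (h1 : 1 < y) (h2 : y < 2) :
    6.907 ≤ fernandezProcacciFun y := by
  have hlog : 0 < Real.log y := Real.log_pos h1
  have h3 : Real.log y ≤ 0.31482 + (y / (137 / 100) - 1) := by
    have h := Real.log_le_sub_one_of_pos (x := y / (137 / 100)) (by positivity)
    rw [Real.log_div (by positivity) (by norm_num)] at h
    linarith [log_one_point_three_seven_le]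
  rw [fernandezProcacciFun, le_div_iff₀ (mul_pos (by linarith) hlog)]
  have h4 := mul_le_mul_of_nonneg_left h3 (show 0 ≤ 2 - y by linarith)
  nlinarith [sq_nonneg (y - 1.37015)]

theorem fernandezProcacciFun_lt : fernandezProcacciFun (137 / 100) < 6.908 := by
  rw [fernandezProcacciFun, div_lt_iff₀ (mul_pos (by norm_num) (Real.log_pos (by norm_num)))]
  nlinarith [le_log_one_point_three_seven]

theorem continuousOn_fernandezProcacciFun :
    ContinuousOn fernandezProcacciFun (Set.Ioo 1 2) := by
  unfold fernandezProcacciFun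
  intro y hy
  refine ContinuousAt.continuousWithinAt ?_
  have h0 : y ≠ 0 := by linarith [hy.1]
  refine continuousAt_id.div ((continuousAt_const.sub continuousAt_id).mul
    (Real.continuousAt_log h0)) ?_
  exact (mul_pos (by linarith [hy.2]) (Real.log_pos hy.1)).ne'

/-- Near the ends of `(1, 2)` the function is larger than at `1.37`, as `log y ≤ y - 1`. -/
theorem exists_isMinOn_fernandezProcacciFun :
    ∃ y ∈ Set.Ioo (1 : ℝ) 2, ∀ x ∈ Set.Ioo (1 : ℝ) 2,
      fernandezProcacciFun y ≤ fernandezProcacciFun x := by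
  have hsub : Set.Icc (1.1 : ℝ) 1.9 ⊆ Set.Ioo 1 2 := fun x hx =>
    ⟨by linarith [hx.1], by linarith [hx.2]⟩
  have hmem : (137 / 100 : ℝ) ∈ Set.Icc (1.1 : ℝ) 1.9 := by constructor <;> norm_num
  obtain ⟨y, hy, hmin⟩ := isCompact_Icc.exists_isMinOn ⟨_, hmem⟩
    (continuousOn_fernandezProcacciFun.mono hsub)
  refine ⟨y, hsub hy, fun x hx => ?_⟩
  by_cases hx' : x ∈ Set.Icc (1.1 : ℝ) 1.9
  · exact hmin hx'
  · refine ((hmin hmem).trans fernandezProcacciFun_lt.le).trans ?_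
    have hlog : 0 < Real.log x := Real.log_pos hx.1
    have hle := Real.log_le_sub_one_of_pos (x := x) (by linarith [hx.1])
    have hx1 := hx.1
    have hx2 := hx.2
    have h2 := mul_le_mul_of_nonneg_left hle (show 0 ≤ 2 - x by linarith)
    rw [fernandezProcacciFun, le_div_iff₀ (mul_pos (by linarith) hlog)]
    rw [Set.mem_Icc, not_and_or, not_le, not_le] at hx'
    rcases hx' with h | h <;> nlinarith

theorem isLeast_fernandezProcacciConstant :
    IsLeast (fernandezProcacciFun '' Set.Ioo 1 2) fernandezProcacciConstant := by
  obtain ⟨y, hy, hmin⟩ := exists_isMinOn_fernandezProcacciFun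
  have h : IsLeast (fernandezProcacciFun '' Set.Ioo 1 2) (fernandezProcacciFun y) :=
    ⟨⟨y, hy, rfl⟩, by rintro _ ⟨x, hx, rfl⟩; exact hmin x hx⟩
  rwa [fernandezProcacciConstant, h.csInf_eq]

theorem le_fernandezProcacciConstant : (6.907 : ℝ) ≤ fernandezProcacciConstant := by
  obtain ⟨y, hy, h⟩ := isLeast_fernandezProcacciConstant.1
  exact h ▸ le_fernandezProcacciFun hy.1 hy.2

theorem fernandezProcacciConstant_lt : fernandezProcacciConstant < (6.908 : ℝ) :=
  (isLeast_fernandezProcacciConstant.2 ⟨137 / 100, by constructor <;> norm_num, rfl⟩).trans_lt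
    fernandezProcacciFun_lt

/-! ### Log-concavity from a disc containing the zeros -/

theorem norm_sub_one_mul_add_one_le {z : ℂ} {q r : ℝ} (hz : ‖z‖ ≤ r) (hq : √2 * r + 1 ≤ q) :
    ‖((q : ℂ) - 1 - z) * ((q : ℂ) + 1 - z)‖ ≤ ‖(q : ℂ) - z‖ ^ 2 := by
  have hxy : |z.re| + |z.im| ≤ √2 * r := by
    have h1 : (|z.re| + |z.im|) ^ 2 ≤ (√2 * r) ^ 2 := by
      rw [mul_pow, Real.sq_sqrt (by norm_num)]
      have h2 : z.re ^ 2 + z.im ^ 2 ≤ r ^ 2 := by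
        have := pow_le_pow_left₀ (norm_nonneg z) hz 2
        rw [Complex.sq_norm, Complex.normSq_apply] at this
        linarith
      nlinarith [sq_nonneg (|z.re| - |z.im|), sq_abs z.re, sq_abs z.im]
    exact abs_le_of_sq_le_sq' h1 (mul_nonneg (by positivity) ((norm_nonneg z).trans hz)) |>.2
  have hre := neg_abs_le z.re
  have hre' := le_abs_self z.re
  have him := neg_abs_le z.im
  have him' := le_abs_self z.im
  -- `q - z` lies in the sector `|Im| + 1 ≤ Re`, so that `(q - z)²` has real part at least `1`.
  have h1 : 1 ≤ (q - z.re) - z.im := by linarith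
  have h2 : 1 ≤ (q - z.re) + z.im := by linarith
  have h3 : 1 ≤ (q - z.re) ^ 2 - z.im ^ 2 := by nlinarith
  refine abs_le_of_sq_le_sq' ?_ (by positivity) |>.2
  rw [norm_mul, mul_pow, ← pow_mul, mul_comm 2 2, pow_mul]
  simp only [Complex.sq_norm, Complex.normSq_apply, Complex.sub_re, Complex.sub_im,
    Complex.add_re, Complex.add_im, Complex.ofReal_re, Complex.ofReal_im, Complex.one_re,
    Complex.one_im]
  nlinarith

/-- A polynomial is log-concave at each `q` that is far enough to the right of a disc about `0`
that contains its zeros: `P(q - 1) P(q + 1) / P(q)²` is the product of the `1 - (q - z)⁻²` over the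
zeros `z`, and `(q - z)²` has real part at least `1`. -/
theorem eval_mul_eval_le_sq {P : ℤ[X]} (r : ℝ)
    (hr : ∀ z : ℂ, aeval z P = 0 → ‖z‖ ≤ r) {q : ℤ} (hq : √2 * r + 1 ≤ q) :
    P.eval (q - 1) * P.eval (q + 1) ≤ P.eval q ^ 2 := by
  set Q : ℂ[X] := P.map (Int.castRingHom ℂ) with hQ
  have hsplit : Q.Splits := IsAlgClosed.splits Q
  have heval : ∀ x : ℤ, ((P.eval x : ℤ) : ℂ) = Q.eval (x : ℂ) := fun x => by
    rw [hQ, eval_intCast_map]; simp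
  have hfac : ∀ x : ℂ, Q.eval x = Q.leadingCoeff * (Q.roots.map fun z => x - z).prod := by
    intro x
    conv_lhs => rw [hsplit.eq_prod_roots]
    simp [eval_multiset_prod]
  have hroot : ∀ z ∈ Q.roots, ‖z‖ ≤ r := fun z hz => hr z (by
    have := (mem_roots'.1 hz).2
    rw [IsRoot.def, hQ, eval_map] at this
    rw [aeval_def]; exact this)
  have hprod : ∀ s : Multiset ℂ, (∀ z ∈ s, ‖z‖ ≤ r) →
      ‖(s.map fun z => ((q : ℂ) - 1) - z).prod * (s.map fun z => ((q : ℂ) + 1) - z).prod‖ ≤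
        ‖(s.map fun z => (q : ℂ) - z).prod‖ ^ 2 := by
    intro s
    induction s using Multiset.induction_on with
    | empty => simp
    | cons a s ih =>
      intro hs
      have h1 := ih fun z hz => hs z (Multiset.mem_cons_of_mem hz)
      have h2 := norm_sub_one_mul_add_one_le (hs a (Multiset.mem_cons_self a s)) hq
      rw [Complex.ofReal_intCast] at h2
      simp only [Multiset.map_cons, Multiset.prod_cons]
      rw [mul_mul_mul_comm, norm_mul, norm_mul ((q : ℂ) - a), mul_pow]
      exact mul_le_mul h2 h1 (norm_nonneg _) (by positivity)
  have hC : ‖Q.eval ((q : ℂ) - 1) * Q.eval ((q : ℂ) + 1)‖ ≤ ‖Q.eval (q : ℂ)‖ ^ 2 := by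
    rw [hfac, hfac, hfac (q : ℂ), mul_mul_mul_comm, norm_mul, norm_mul Q.leadingCoeff, ← sq,
      norm_mul Q.leadingCoeff, mul_pow]
    exact mul_le_mul_of_nonneg_left (hprod _ hroot) (by positivity)
  have h1 := heval (q - 1)
  have h2 := heval (q + 1)
  push_cast at h1 h2
  rw [← h1, ← h2, ← heval, ← Int.cast_mul, ← norm_pow, ← Int.cast_pow, Complex.norm_intCast,
    Complex.norm_intCast] at hC
  have h3 : |P.eval (q - 1) * P.eval (q + 1)| ≤ |P.eval q ^ 2| := by exact_mod_cast hC
  rw [abs_of_nonneg (sq_nonneg (P.eval q))] at h3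
  exact (le_abs_self _).trans h3

/-! ### Zeros of the chromatic polynomial and log-concavity -/

/-- The zeros of the chromatic polynomial lie in the disc of radius `K* Δ` about `0`. -/
theorem norm_le_of_aeval_chromaticPolynomial_eq_zero {V : Type*} [Fintype V] [DecidableEq V]
    (G : SimpleGraph V) [DecidableRel G.Adj] {z : ℂ} (hz : aeval z (chromaticPolynomial G) = 0) :
    ‖z‖ ≤ fernandezProcacciConstant * G.maxDegree := by
  obtain ⟨Y, ⟨hY1, hY2⟩, hY⟩ := isLeast_fernandezProcacciConstant.1
  by_contra! hlt
  have hK : 0 ≤ fernandezProcacciConstant := by linarith [le_fernandezProcacciConstant]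
  have hz0 : 0 < ‖z‖ := lt_of_le_of_lt (by positivity) hlt
  have hlog : 0 < Real.log Y := Real.log_pos hY1
  have h2Y : 0 < 2 - Y := by linarith
  refine (aeval_inducedChromatic_ne_zero G hY2 (norm_pos_iff.1 hz0) ?_ Finset.univ).1
    (by rwa [inducedChromatic_univ])
  rw [← Real.le_log_iff_exp_le (by linarith)]
  rw [← hY, fernandezProcacciFun, div_mul_eq_mul_div, div_lt_iff₀ (mul_pos h2Y hlog)] at hlt
  have : (2 - Y)⁻¹ / ‖z‖ * G.maxDegree * Y = Y * G.maxDegree / (‖z‖ * (2 - Y)) := by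
    field_simp
  rw [this, div_le_iff₀ (mul_pos hz0 h2Y)]
  linarith

theorem chromaticPolynomial_log_concave {V : Type*} [Fintype V] [DecidableEq V]
    (G : SimpleGraph V) [DecidableRel G.Adj] {q : ℤ}
    (hq : √2 * fernandezProcacciConstant * (G.maxDegree : ℝ) + 1 ≤ (q : ℝ)) :
    (chromaticPolynomial G).eval (q - 1) * (chromaticPolynomial G).eval (q + 1) ≤
      (chromaticPolynomial G).eval q ^ 2 :=
  eval_mul_eval_le_sq (fernandezProcacciConstant * G.maxDegree)
    (fun _ hz => norm_le_of_aeval_chromaticPolynomial_eq_zero G hz) (by rwa [← mul_assoc])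

theorem theorem2 :
    -- log-concavity holds above `C Δ + 1` for some constant `C` valid for all graphs
    (∃ C : ℝ, ∀ (V : Type u) [Fintype V] [DecidableEq V] (G : SimpleGraph V) [DecidableRel G.Adj]
      (q : ℤ), C * (G.maxDegree : ℝ) + 1 ≤ (q : ℝ) →
        (chromaticPolynomial G).eval (q - 1) * (chromaticPolynomial G).eval (q + 1) ≤
          (chromaticPolynomial G).eval q ^ 2) ∧
    -- the constant `K*` is a minimum that is attained, and `K* = 6.907…`
    IsLeast (fernandezProcacciFun '' Set.Ioo 1 2) fernandezProcacciConstant ∧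
    (6.907 : ℝ) ≤ fernandezProcacciConstant ∧ fernandezProcacciConstant < (6.908 : ℝ) ∧
    -- in particular one may take `C = √2 K*`
    (∀ (V : Type u) [Fintype V] [DecidableEq V] (G : SimpleGraph V) [DecidableRel G.Adj]
      (q : ℤ), √2 * fernandezProcacciConstant * (G.maxDegree : ℝ) + 1 ≤ (q : ℝ) →
        (chromaticPolynomial G).eval (q - 1) * (chromaticPolynomial G).eval (q + 1) ≤
          (chromaticPolynomial G).eval q ^ 2) := 
  ⟨⟨√2 * fernandezProcacciConstant, fun _ _ _ G _ _ hq => chromaticPolynomial_log_concave G hq⟩,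
    isLeast_fernandezProcacciConstant, le_fernandezProcacciConstant,
    fernandezProcacciConstant_lt, fun _ _ _ G _ _ hq => chromaticPolynomial_log_concave G hq⟩
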